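/- Let $n$ be a dimension and let $\mathcal B$ be a collection of bounded open convex subsets of $\mathbb R^n$ that is homothecy invariant: $v+cR\in\mathcal B$ for all $R\in\mathcal B$, $v\in\mathbb R^n$ and $c>0$. Suppose that $\mathcal B$ is a density basis, that is, it differentiates $L^\infty(\mathbb R^n)$: for every $f\in L^\infty(\mathbb R^n)$ and almost every $x\in\mathbb R^n$, there are members of $\mathcal B$ of arbitrarily small diameter containing $x$, and $$\frac1{|R|}\int_R f\longrightarrow f(x)\qquad\text{as } \operatorname{diam} R\to 0,\ x\in R\in\mathcal B .$$ Define $$M_{\mathcal B}f(x)=\sup_{x\in R\in\mathcal B}\frac1{|R|}\int_R|f|$$ (with the value $0$ if no member of $\mathcal B$ contains $x$), the sharp Tauberian constant $$C_{\mathcal B}(\alpha)=\sup_{E:\ 0<|E|<\infty}\frac1{|E|}\bigl|\{x\in\mathbb R^n: M_{\mathcal B}\chi_E(x)>\alpha\}\bigr|,\qquad 0<\alpha<1,$$ where $E$ ranges over the measurable subsets of $\mathbb R^n$, and the halo function $\phi_{\mathcal B}$ on $[0,\infty)$ by $\phi_{\mathcal B}(a)=a$ for $0\le a\le 1$ and $\phi_{\mathcal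 B}(a)=C_{\mathcal B}(1/a)$ for $a>1$. For an interval $I\subset\mathbb R$ and $0<p<1$, write $f\in C^p(I)$ if for every compact $K\subset I$ there is a constant $A_K$ with $|f(x)-f(y)|\le A_K|x-y|^p$ for all $x,y\in K$. Let $0<p<1$ and suppose that there are constants $A>0$ and $\alpha_0\in(0,1)$ such that $C_{\mathcal B}(\alpha)-1\le A(1-\alpha)^p$ for all $\alpha\in(\alpha_0,1)$. Then $C_{\mathcal B}$ is finite on $(0,1)$ and $$C_{\mathcal B}\in C^p\bigl((0,1)\bigr),$$ and $\phi_{\mathcal B}$ is finite on $[0,\infty)$ and $$\phi_{\mathcal B}\in C^p\bigl([0,\infty)\bigr).$$ -/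

import Mathlib

open Set Filter Topology MeasureTheory
open scoped ENNReal NNReal

noncomputable section

namespace Halo

/-- A basis in `ℝⁿ`: a collection of bounded open sets. -/
def IsBasis {n : ℕ} (B : Set (Set (EuclideanSpace ℝ (Fin n)))) : Prop :=
  ∀ R ∈ B, IsOpen R ∧ Bornology.IsBounded R

/-- Invariance under all translations and all dilations of positive ratio. -/
def HomothecyInvariant {n : ℕ} (B : Set (Set (EuclideanSpace ℝ (Fin n)))) : Prop :=
  ∀ R ∈ B, ∀ c : ℝ, 0 < c → ∀ v : EuclideanSpace ℝ (Fin n), (fun x => v + c • x) '' R ∈ B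

/-- `B` differentiates `f`: for almost every `x`, there are members of `B` of arbitrarily small
diameter containing `x`, and the averages of `f` over the members of `B` containing `x` converge
to `f x` as their diameters tend to zero. -/
def Differentiates {n : ℕ} (B : Set (Set (EuclideanSpace ℝ (Fin n))))
    (f : EuclideanSpace ℝ (Fin n) → ℝ) : Prop :=
  ∀ᵐ x ∂(volume : Measure (EuclideanSpace ℝ (Fin n))),
    (∀ r > 0, ∃ R ∈ B, x ∈ R ∧ Metric.diam R < r) ∧
    ∀ ε > 0, ∃ r > 0, ∀ R ∈ B, x ∈ R → Metric.diam R < r → |(⨍ y in R, f y) - f x| < ε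

/-- A density basis: a basis that differentiates every function in `L^∞(ℝⁿ)`. -/
def IsDensityBasis {n : ℕ} (B : Set (Set (EuclideanSpace ℝ (Fin n)))) : Prop :=
  IsBasis B ∧ ∀ f : EuclideanSpace ℝ (Fin n) → ℝ, MemLp f ∞ volume → Differentiates B f

/-- The maximal operator `M_B f (x) = sup_{x ∈ R ∈ B} |R|⁻¹ ∫_R |f|`, with value `0` at points
that lie in no member of `B`. -/
def maximalOperator {n : ℕ} (B : Set (Set (EuclideanSpace ℝ (Fin n))))
    (f : EuclideanSpace ℝ (Fin n) → ℝ) (x : EuclideanSpace ℝ (Fin n)) : ℝ≥0∞ :=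
  ⨆ (R : Set (EuclideanSpace ℝ (Fin n))) (_ : R ∈ B) (_ : x ∈ R), ⨍⁻ y in R, ‖f y‖ₑ ∂volume

/-- The halo set `{x : M_B χ_E (x) > α}`. -/
def haloSet {n : ℕ} (B : Set (Set (EuclideanSpace ℝ (Fin n)))) (α : ℝ)
    (E : Set (EuclideanSpace ℝ (Fin n))) : Set (EuclideanSpace ℝ (Fin n)) :=
  {x | ENNReal.ofReal α < maximalOperator B (E.indicator fun _ => (1 : ℝ)) x}

/-- The sharp Tauberian constant
`C_B(α) = sup_{0 < |E| < ∞} |E|⁻¹ |{x : M_B χ_E (x) > α}|`, a priori possibly infinite. -/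
def sharpTauberian {n : ℕ} (B : Set (Set (EuclideanSpace ℝ (Fin n)))) (α : ℝ) : ℝ≥0∞ :=
  ⨆ (E : Set (EuclideanSpace ℝ (Fin n))) (_ : MeasurableSet E) (_ : 0 < volume E)
    (_ : volume E < ∞), volume (haloSet B α E) / volume E

/-- The halo function on `[0, ∞)`: `φ_B(a) = a` for `0 ≤ a ≤ 1`, and
`φ_B(a) = sup_{0 < |E| < ∞} |E|⁻¹ |{x : M_B χ_E (x) > 1 / a}|` for `a > 1`. -/
def haloFunction {n : ℕ} (B : Set (Set (EuclideanSpace ℝ (Fin n)))) (a : ℝ) : ℝ≥0∞ :=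
  if a ≤ 1 then ENNReal.ofReal a else sharpTauberian B (1 / a)

/-- The Solyanik estimate `C_B(α) - 1 ≤ A (1 - α)^p` for `α < 1` sufficiently close to `1`. -/
def SolyanikEstimate {n : ℕ} (B : Set (Set (EuclideanSpace ℝ (Fin n)))) (p : ℝ≥0) : Prop :=
  ∃ A : ℝ, ∀ᶠ α : ℝ in 𝓝[<] 1, sharpTauberian B α - 1 ≤ ENNReal.ofReal (A * (1 - α) ^ (p : ℝ))

/-- The class `C^p(I)`: on every compact subset of `I`, `f` is Hölder continuous of exponent `p`,
with a constant that may depend on the compact set. -/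
def LocallyHolder (p : ℝ≥0) (f : ℝ → ℝ) (I : Set ℝ) : Prop :=
  ∀ K ⊆ I, IsCompact K → ∃ A : ℝ≥0, HolderOnWith A p f K

end Halo

end

namespace Halo

open scoped Pointwise

/-! ### Homothets of a convex set and its difference body. -/

section Geometry

variable {V : Type*} [NormedAddCommGroup V] [NormedSpace ℝ V]

/-! Write `H_γ(E)` for the halo set and `C` for the Tauberian constant. Halo sets gain mass inside
each `R ∈ B`: if `E` has density at most `γ` in `R`, shrink `R` about almost every point of `E ∩ R`
until the density of `E` first exceeds `γ`. By convexity these homothets stay in `R`, they lie in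
`H_γ(E)`, and a fixed proportion of order `1 - γ` of each is outside `E`. A Vitali selection then
gives `|H_γ(E) ∩ R| ≥ (1 + c(1 - γ)) |E ∩ R|` with `c` depending only on `n`
(`measure_inter_haloSet_ge`).

Hence `H_α(E) ⊆ H_β(H_γ(E))` for `β = α(1 + c(1 - γ)) < 1`, so `C(α) ≤ C(β) C(γ)`
(`sharpTauberian_le_mul`). Iteration gives finiteness. Given `α < β` close together, solving for `γ`
makes `1 - γ` comparable to `β - α`, and `C(α) - C(β) ≤ C(β)(C(γ) - 1)` turns the Solyanik estimate
into a Hölder bound (`exists_holder_bound`). -/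

theorem homothety_image_subset {K : Set V} (hK : Convex ℝ K) {x : V} (hx : x ∈ K) {t : ℝ}
    (ht : t ∈ Icc (0 : ℝ) 1) : AffineMap.homothety x t '' K ⊆ K := by
  rintro _ ⟨y, hy, rfl⟩
  rw [AffineMap.homothety_apply, vsub_eq_sub, vadd_eq_add, add_comm]
  exact hK.add_smul_sub_mem hx hy ht

theorem homothety_image_mono {K : Set V} (hK : Convex ℝ K) {x : V} (hx : x ∈ K) {s t : ℝ}
    (hs : 0 ≤ s) (hst : s ≤ t) :
    AffineMap.homothety x s '' K ⊆ AffineMap.homothety x t '' K := by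
  rcases hs.eq_or_lt with rfl | hs0
  · rintro _ ⟨y, -, rfl⟩
    exact ⟨x, hx, by simp⟩
  · have ht : 0 < t := hs0.trans_le hst
    rintro _ ⟨y, hy, rfl⟩
    refine ⟨AffineMap.homothety x (s / t) y,
      homothety_image_subset hK hx ⟨by positivity, (div_le_one ht).2 hst⟩ ⟨y, hy, rfl⟩, ?_⟩
    rw [← AffineMap.homothety_mul_apply, mul_div_cancel₀ _ ht.ne']

/-- The elementary difference body inequality, with constant `4 ^ d`. -/
theorem measure_sub_le [MeasurableSpace V] [BorelSpace V] [FiniteDimensional ℝ V]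
    (μ : Measure V) [μ.IsAddHaarMeasure] {K : Set V} (hK : Convex ℝ K) (ho : IsOpen K)
    (hfin : μ K ≠ ∞) : μ (K - K) ≤ 4 ^ Module.finrank ℝ V * μ K := by
  set d := Module.finrank ℝ V
  rcases K.eq_empty_or_nonempty with rfl | hne
  · simp
  have hpos : μ K ≠ 0 := (ho.measure_pos μ hne).ne'
  set S : Set V := (1 / 2 : ℝ) • (K - K) with hS
  have hSm : MeasurableSet S := (ho.sub_left.smul₀ (by norm_num)).measurableSet
  have hKm := ho.measurableSet
  have hhalf : ENNReal.ofReal |(1 / 2 : ℝ) ^ d| = (2 ^ d)⁻¹ := by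
    rw [abs_of_pos (by positivity), one_div, inv_pow, ENNReal.ofReal_inv_of_pos (by positivity),
      ENNReal.ofReal_pow (by norm_num), ENNReal.ofReal_ofNat]
  -- The inner integral is `μ (K ∩ (K - x))`, with total integral `μ(K)²`. For `x = (u - v)/2` that
  -- set contains the half-size copy of `K` about `v`, which bounds it below on `S`.
  set f : V → V → ℝ≥0∞ := fun x y => K.indicator 1 y * K.indicator 1 (x + y)
  have hfm : Measurable (Function.uncurry f) := by
    have h1 : Measurable (K.indicator (1 : V → ℝ≥0∞)) := measurable_one.indicator hKm
    exact (h1.comp measurable_snd).mul (h1.comp (measurable_fst.add measurable_snd))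
  have hint : ∫⁻ x, ∫⁻ y, f x y ∂μ ∂μ = μ K * μ K := by
    rw [lintegral_lintegral_swap hfm.aemeasurable]
    have h2 : ∀ y, ∫⁻ x, f x y ∂μ = K.indicator 1 y * μ K := by
      intro y
      have h1 : Measurable (K.indicator (1 : V → ℝ≥0∞)) := measurable_one.indicator hKm
      change ∫⁻ x, K.indicator 1 y * K.indicator 1 (x + y) ∂μ = _
      have h3 : Measurable fun x => K.indicator (1 : V → ℝ≥0∞) (x + y) :=
        h1.comp (measurable_add_const y)
      rw [lintegral_const_mul _ h3,
        lintegral_add_right_eq_self (K.indicator 1) y, lintegral_indicator_one hKm]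
    simp_rw [h2]
    rw [lintegral_mul_const _ (measurable_one.indicator hKm), lintegral_indicator_one hKm]
  have hlow : ∀ x ∈ S, (2 ^ d)⁻¹ * μ K ≤ ∫⁻ y, f x y ∂μ := by
    rintro _ ⟨_, ⟨u, hu, v, hv, rfl⟩, rfl⟩
    rw [← hhalf, ← Measure.addHaar_image_homothety μ v]
    have hsub : AffineMap.homothety v (1 / 2 : ℝ) '' K ⊆
        {y | y ∈ K ∧ (1 / 2 : ℝ) • (u - v) + y ∈ K} := by
      rintro _ ⟨k, hk, rfl⟩
      refine ⟨homothety_image_subset hK hv (by norm_num) ⟨k, hk, rfl⟩, ?_⟩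
      have := hK.add_smul_sub_mem hu hk (t := 1 / 2) (by norm_num)
      convert this using 1
      rw [AffineMap.homothety_apply, vsub_eq_sub, vadd_eq_add]
      module
    have hm : MeasurableSet {y | y ∈ K ∧ (1 / 2 : ℝ) • (u - v) + y ∈ K} :=
      hKm.inter (measurable_const_add _ hKm)
    refine (measure_mono hsub).trans ?_
    rw [← lintegral_indicator_one hm]
    refine lintegral_mono fun y => ?_
    by_cases hy : y ∈ K <;> by_cases hy' : (1 / 2 : ℝ) • (u - v) + y ∈ K <;>
      simp_all [f, indicator]
  have key : (2 ^ d)⁻¹ * μ K * μ S ≤ μ K * μ K := by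
    rw [← hint, ← setLIntegral_const]
    exact (setLIntegral_mono' hSm hlow).trans (setLIntegral_le_lintegral _ _)
  rw [hS, Measure.addHaar_smul, hhalf] at key
  have h4 : (4 : ℝ≥0∞) ^ d = 2 ^ d * 2 ^ d := by rw [← mul_pow]; norm_num
  have h2 : (2 : ℝ≥0∞) ^ d * (2 ^ d)⁻¹ = 1 := ENNReal.mul_inv_cancel (by simp) (by simp)
  rw [← ENNReal.mul_le_mul_iff_right hpos hfin, h4]
  calc μ K * μ (K - K) = (2 ^ d * (2 ^ d)⁻¹) * (2 ^ d * (2 ^ d)⁻¹) * (μ K * μ (K - K)) := by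
        rw [h2, one_mul, one_mul]
    _ = 2 ^ d * 2 ^ d * ((2 ^ d)⁻¹ * μ K * ((2 ^ d)⁻¹ * μ (K - K))) := by ring
    _ ≤ 2 ^ d * 2 ^ d * (μ K * μ K) := by gcongr
    _ = μ K * (2 ^ d * 2 ^ d * μ K) := by ring

/-- If homothets of a convex set `K` about two of its points intersect and one is at most twice
as large as the other, its centre lies in a fixed enlargement of the other. -/
theorem center_mem_of_homothety_inter {K : Set V} (hK : Convex ℝ K) {a b : V} (ha : a ∈ K)
    (hb : b ∈ K) {s t : ℝ} (hs : 0 ≤ s) (ht : 0 < t) (hst : s ≤ 2 * t)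
    (h : (AffineMap.homothety a s '' K ∩ AffineMap.homothety b t '' K).Nonempty) :
    a ∈ AffineMap.homothety b (3 * t) '' ((fun x => b + x) '' (K - K)) := by
  obtain ⟨_, ⟨k, hk, rfl⟩, ⟨l, hl, hkl⟩⟩ := h
  have hD : Convex ℝ (K - K) := hK.sub hK
  have h0 : (0 : V) ∈ K - K := ⟨a, ha, a, ha, sub_self a⟩
  have h1 : l - b ∈ K - K := ⟨l, hl, b, hb, rfl⟩
  have h2 : (s / (2 * t)) • (a - k) ∈ K - K := by
    have := hD.add_smul_sub_mem h0 (⟨a, ha, k, hk, rfl⟩ : a - k ∈ K - K) (t := s / (2 * t))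
      ⟨by positivity, (div_le_one (by positivity)).2 hst⟩
    simpa using this
  -- The common point gives `a - b = t(l - b) + s(a - k)`, which is `3t` times this convex
  -- combination.
  have h3 := hD h1 h2 (by norm_num : (0 : ℝ) ≤ 1 / 3) (by norm_num : (0 : ℝ) ≤ 2 / 3) (by norm_num)
  refine ⟨_, ⟨_, h3, rfl⟩, ?_⟩
  simp only [AffineMap.homothety_apply, vsub_eq_sub, vadd_eq_add] at hkl ⊢
  have e : (3 * t) • ((2 / 3 : ℝ) • ((s / (2 * t)) • (a - k))) = s • (a - k) := by
    rw [smul_smul, smul_smul]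
    congr 1
    field_simp
  have e' : (3 * t) • ((1 / 3 : ℝ) • (l - b)) = t • (l - b) := by
    rw [smul_smul]
    congr 1
    ring
  rw [add_sub_cancel_left, smul_add, e, e', eq_sub_of_add_eq hkl]
  module

end Geometry

end Halo

namespace Halo

open scoped Pointwise

/-! ### Halo sets, the gain of density, and submultiplicativity. -/

section Basis

variable {n : ℕ} {B : Set (Set (EuclideanSpace ℝ (Fin n)))} {E : Set (EuclideanSpace ℝ (Fin n))}
  {R : Set (EuclideanSpace ℝ (Fin n))}

theorem laverage_indicator_one (hE : MeasurableSet E) :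
    ⨍⁻ y in R, ‖E.indicator (fun _ => (1 : ℝ)) y‖ₑ ∂volume = volume (E ∩ R) / volume R := by
  have : (fun y => ‖E.indicator (fun _ => (1 : ℝ)) y‖ₑ) = E.indicator 1 := by
    ext y
    by_cases hy : y ∈ E <;> simp [hy]
  rw [setLAverage_eq, this, lintegral_indicator_one hE, Measure.restrict_apply hE]

theorem IsBasis.measure_ne_top (hB : IsBasis B) (hR : R ∈ B) : volume R ≠ ∞ :=
  (hB R hR).2.measure_lt_top.ne

theorem mem_haloSet_iff (hB : IsBasis B) (hE : MeasurableSet E) {α : ℝ}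
    {x : EuclideanSpace ℝ (Fin n)} :
    x ∈ haloSet B α E ↔
      ∃ R ∈ B, x ∈ R ∧ ENNReal.ofReal α * volume R < volume (E ∩ R) := by
  simp only [haloSet, maximalOperator, mem_ofPred_eq, lt_iSup_iff, exists_prop]
  refine exists_congr fun R => and_congr_right fun hR => and_congr_right fun hx => ?_
  rw [laverage_indicator_one hE, ENNReal.lt_div_iff_mul_lt
    (Or.inl ((hB R hR).1.measure_pos volume ⟨x, hx⟩).ne') (Or.inl (hB.measure_ne_top hR))]

/-- Provides the measurability that lets a halo set serve in turn as a test set. -/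
theorem isOpen_haloSet (hB : IsBasis B) (hE : MeasurableSet E) (α : ℝ) :
    IsOpen (haloSet B α E) := by
  rw [isOpen_iff_mem_nhds]
  intro x hx
  obtain ⟨R, hR, hxR, h⟩ := (mem_haloSet_iff hB hE).1 hx
  exact mem_of_superset ((hB R hR).1.mem_nhds hxR)
    fun y hy => (mem_haloSet_iff hB hE).2 ⟨R, hR, hy, h⟩

theorem haloSet_anti {α β : ℝ} (h : α ≤ β) : haloSet B β E ⊆ haloSet B α E :=
  fun _ hx => (ENNReal.ofReal_le_ofReal h).trans_lt hx

theorem sharpTauberian_antitone : Antitone (sharpTauberian B) := fun _ _ h =>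
  iSup_mono fun _ => iSup_mono fun _ => iSup_mono fun _ => iSup_mono fun _ =>
    ENNReal.div_le_div_right (measure_mono (haloSet_anti h)) _

theorem measure_haloSet_le (hB : IsBasis B) (hE : MeasurableSet E) (hfin : volume E ≠ ∞) (α : ℝ) :
    volume (haloSet B α E) ≤ sharpTauberian B α * volume E := by
  -- Null sets are excluded from the supremum, but their halo sets are empty.
  rcases eq_or_ne (volume E) 0 with h0 | h0
  · have : haloSet B α E = ∅ := by
      refine eq_empty_of_forall_notMem fun x hx => ?_
      obtain ⟨R, -, -, h⟩ := (mem_haloSet_iff hB hE).1 hx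
      rw [measure_mono_null inter_subset_left h0] at h
      exact not_lt_zero h
    simp [this]
  · rw [← ENNReal.div_le_iff h0 hfin]
    exact le_iSup_of_le E (le_iSup_of_le hE (le_iSup_of_le h0.bot_lt
      (le_iSup_of_le hfin.lt_top le_rfl)))

/-- Almost every point of a ball lies in a member of `B` contained in the ball, where the density is
`1`. -/
theorem one_le_sharpTauberian (hB : IsDensityBasis B) {α : ℝ} (hα : α < 1) :
    1 ≤ sharpTauberian B α := by
  set U := Metric.ball (0 : EuclideanSpace ℝ (Fin n)) 1
  have hU : volume U ≠ ∞ := measure_ball_lt_top.ne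
  have hU0 : volume U ≠ 0 := (Metric.measure_ball_pos volume _ one_pos).ne'
  have hd := hB.2 (fun _ => 0) (memLp_top_const 0)
  have hsub : U ≤ᵐ[volume] haloSet B α U := by
    filter_upwards [hd] with x hx hxU
    obtain ⟨r, hr, hball⟩ := Metric.isOpen_ball.mem_nhds hxU |> Metric.mem_nhds_iff.1
    obtain ⟨R, hR, hxR, hdiam⟩ := hx.1 r hr
    refine (mem_haloSet_iff hB.1 measurableSet_ball).2 ⟨R, hR, hxR, ?_⟩
    have hRU : R ⊆ U := fun y hy => hball
      ((Metric.dist_le_diam_of_mem (hB.1 R hR).2 hy hxR).trans_lt hdiam)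
    rw [inter_eq_self_of_subset_right hRU]
    calc ENNReal.ofReal α * volume R < 1 * volume R := by
          refine (ENNReal.mul_lt_mul_iff_left ?_ (hB.1.measure_ne_top hR)).2
            (by rwa [← ENNReal.ofReal_one, ENNReal.ofReal_lt_ofReal_iff one_pos])
          exact ((hB.1 R hR).1.measure_pos volume ⟨x, hxR⟩).ne'
      _ = volume R := one_mul _
  have h := (measure_mono_ae hsub).trans (measure_haloSet_le hB.1 measurableSet_ball hU α)
  rwa [← ENNReal.mul_le_mul_iff_left hU0 hU, one_mul]

theorem homothety_image_mem (hhom : HomothecyInvariant B) (hR : R ∈ B)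
    (x : EuclideanSpace ℝ (Fin n)) {t : ℝ} (ht : 0 < t) :
    AffineMap.homothety x t '' R ∈ B := by
  have h : AffineMap.homothety x t '' R = (fun y => (x - t • x) + t • y) '' R := by
    refine image_congr fun y _ => ?_
    rw [AffineMap.homothety_apply, vsub_eq_sub, vadd_eq_add]
    module
  exact h ▸ hhom R hR t ht (x - t • x)

theorem volume_homothety_image (x : EuclideanSpace ℝ (Fin n)) {t : ℝ} (ht : 0 ≤ t)
    (s : Set (EuclideanSpace ℝ (Fin n))) :
    volume (AffineMap.homothety x t '' s) = ENNReal.ofReal t ^ n * volume s := by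
  rw [Measure.addHaar_image_homothety, finrank_euclideanSpace_fin, abs_of_nonneg (by positivity),
    ENNReal.ofReal_pow ht]

theorem lt_measure_inter_of_abs_average_sub_one_lt (hE : MeasurableSet E) {γ : ℝ} (hγ : 0 ≤ γ)
    (hR : volume R ≠ ∞) (hR0 : volume R ≠ 0)
    (h : |(⨍ y in R, E.indicator (fun _ => (1 : ℝ)) y) - 1| < 1 - γ) :
    ENNReal.ofReal γ * volume R < volume (E ∩ R) := by
  have hER : volume (E ∩ R) ≠ ∞ := ne_top_of_le_ne_top hR (measure_mono inter_subset_right)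
  have hpos : 0 < volume.real R := ENNReal.toReal_pos hR0 hR
  have h1 : (⨍ y in R, E.indicator (fun _ => (1 : ℝ)) y) =
      (volume.real R)⁻¹ * volume.real (E ∩ R) := by
    rw [setAverage_eq, integral_indicator hE, setIntegral_const, smul_eq_mul, smul_eq_mul, mul_one,
      measureReal_restrict_apply hE]
  rw [h1, abs_lt] at h
  have h2 : γ * volume.real R < volume.real (E ∩ R) := by
    have : γ < volume.real (E ∩ R) / volume.real R := by
      rw [div_eq_inv_mul]
      linarith [h.1]
    rwa [lt_div_iff₀ hpos] at this
  rw [← ofReal_measureReal hR, ← ofReal_measureReal hER, ← ENNReal.ofReal_mul hγ]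
  exact (ENNReal.ofReal_lt_ofReal_iff_of_nonneg (by positivity)).2 h2

/-- If `E` has density at most `γ` in `R`, almost every point of `E ∩ R` is the centre of a
homothet of `R` in which the density of `E` exceeds `γ`, but not by much. -/
theorem ae_exists_homothety (hB : IsDensityBasis B) (hhom : HomothecyInvariant B)
    (hE : MeasurableSet E) (hR : R ∈ B) (hconv : Convex ℝ R) {γ : ℝ} (hγ0 : 0 < γ) (hγ1 : γ < 1)
    (h : volume (E ∩ R) ≤ ENNReal.ofReal γ * volume R) :
    ∀ᵐ x, x ∈ E ∩ R → ∃ t : ℝ, 0 < t ∧ t ≤ 1 ∧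
      ENNReal.ofReal γ * volume (AffineMap.homothety x t '' R) <
        volume (E ∩ AffineMap.homothety x t '' R) ∧
      ENNReal.ofReal ((1 - γ) / 2) * volume (AffineMap.homothety x t '' R) ≤
        volume (AffineMap.homothety x t '' R \ E) := by
  -- One shrinking step by `l` divides volume by `l ^ (-n)`, so it raises a density bound `γ` to at
  -- most `(1 + γ) / 2`.
  obtain ⟨l, hl, hl0, hl1⟩ : ∃ l : ℝ, γ < (1 + γ) / 2 * l ^ n ∧ 0 < l ∧ l < 1 := by
    have hc : Tendsto (fun l : ℝ => (1 + γ) / 2 * l ^ n) (𝓝[<] 1) (𝓝 ((1 + γ) / 2)) := by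
      have : Continuous fun l : ℝ => (1 + γ) / 2 * l ^ n := by fun_prop
      simpa using (this.tendsto 1).mono_left nhdsWithin_le_nhds
    exact ((hc.eventually_const_lt (by linarith : γ < (1 + γ) / 2)).and
      (Ioo_mem_nhdsLT one_pos)).exists
  filter_upwards [hB.2 _ ((memLp_top_const (1 : ℝ)).indicator hE)] with x hx hxm
  obtain ⟨hxE, hxR⟩ := hxm
  obtain ⟨r, hr, hr'⟩ := hx.2 (1 - γ) (by linarith)
  have hball : ∀ k : ℕ, AffineMap.homothety x (l ^ k) '' R ∈ B := fun k =>
    homothety_image_mem hhom hR x (by positivity)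
  have hmem : ∀ k : ℕ, x ∈ AffineMap.homothety x (l ^ k) '' R := fun k => ⟨x, hxR, by simp⟩
  have hfin : ∀ k : ℕ, volume (AffineMap.homothety x (l ^ k) '' R) ≠ ∞ := fun k =>
    hB.1.measure_ne_top (hball k)
  have hne : ∀ k : ℕ, volume (AffineMap.homothety x (l ^ k) '' R) ≠ 0 := fun k =>
    ((hB.1 _ (hball k)).1.measure_pos volume ⟨x, hmem k⟩).ne'
  have hex : ∃ k : ℕ, ENNReal.ofReal γ * volume (AffineMap.homothety x (l ^ k) '' R) <
      volume (E ∩ AffineMap.homothety x (l ^ k) '' R) := by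
    have ht : Tendsto (fun k : ℕ => l ^ k * Metric.diam R) atTop (𝓝 0) := by
      simpa using (tendsto_pow_atTop_nhds_zero_of_lt_one hl0.le hl1).mul_const (Metric.diam R)
    obtain ⟨k, hk⟩ := (ht.eventually_lt_const hr).exists
    refine ⟨k, lt_measure_inter_of_abs_average_sub_one_lt hE hγ0.le (hfin k) (hne k) ?_⟩
    have hdiam : Metric.diam (AffineMap.homothety x (l ^ k) '' R) < r := by
      refine lt_of_le_of_lt (Metric.diam_le_of_forall_dist_le (by positivity) ?_) hk
      rintro _ ⟨y, hy, rfl⟩ _ ⟨z, hz, rfl⟩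
      rw [AffineMap.homothety_apply, AffineMap.homothety_apply, vsub_eq_sub, vsub_eq_sub,
        vadd_eq_add, vadd_eq_add, dist_add_right, dist_smul₀, dist_sub_right,
        Real.norm_of_nonneg (by positivity)]
      gcongr
      exact Metric.dist_le_diam_of_mem (hB.1 R hR).2 hy hz
    simpa [hxE] using hr' _ (hball k) (hmem k) hdiam
  classical
  obtain ⟨k, hk, hmin⟩ : ∃ k : ℕ, ENNReal.ofReal γ * volume (AffineMap.homothety x (l ^ k) '' R) <
      volume (E ∩ AffineMap.homothety x (l ^ k) '' R) ∧
      ∀ j < k, volume (E ∩ AffineMap.homothety x (l ^ j) '' R) ≤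
        ENNReal.ofReal γ * volume (AffineMap.homothety x (l ^ j) '' R) :=
    ⟨Nat.find hex, Nat.find_spec hex, fun j hj => not_lt.1 (Nat.find_min hex hj)⟩
  refine ⟨l ^ k, by positivity, pow_le_one₀ hl0.le hl1.le, hk, ?_⟩
  -- The first good index is not `0`, since `R` itself has density at most `γ`; its predecessor
  -- controls the density from above.
  obtain ⟨j, rfl⟩ : ∃ j, k = j + 1 := by
    refine Nat.exists_eq_succ_of_ne_zero ?_
    rintro rfl
    simp only [pow_zero, AffineMap.homothety_one, AffineMap.id_apply, AffineMap.coe_id,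
      image_id] at hk
    exact absurd h (not_le.2 hk)
  set S := AffineMap.homothety x (l ^ (j + 1)) '' R
  have hup : volume (E ∩ S) ≤ ENNReal.ofReal ((1 + γ) / 2) * volume S := by
    calc volume (E ∩ S) ≤ volume (E ∩ AffineMap.homothety x (l ^ j) '' R) :=
          measure_mono (inter_subset_inter_right _ (homothety_image_mono hconv hxR (by positivity)
            (pow_le_pow_of_le_one hl0.le hl1.le j.le_succ)))
      _ ≤ ENNReal.ofReal γ * volume (AffineMap.homothety x (l ^ j) '' R) := hmin j j.lt_succ_self
      _ ≤ ENNReal.ofReal ((1 + γ) / 2 * l ^ n) *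
          volume (AffineMap.homothety x (l ^ j) '' R) := by gcongr
      _ = ENNReal.ofReal ((1 + γ) / 2) * volume S := by
          rw [volume_homothety_image x (by positivity), volume_homothety_image x (by positivity),
            ENNReal.ofReal_mul (by positivity), ENNReal.ofReal_pow hl0.le, pow_succ,
            ENNReal.ofReal_mul (by positivity), mul_pow]
          ring
  have hsum : volume S = volume (E ∩ S) + volume (S \ E) := by
    rw [inter_comm, measure_inter_add_sdiff S hE]
  have hsplit : volume S =
      ENNReal.ofReal ((1 + γ) / 2) * volume S + ENNReal.ofReal ((1 - γ) / 2) * volume S := by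
    rw [← add_mul, ← ENNReal.ofReal_add (by linarith) (by linarith)]
    ring_nf
    simp
  refine (ENNReal.add_le_add_iff_left
    (ENNReal.mul_ne_top ENNReal.ofReal_ne_top (hfin (j + 1)))).1 (hsplit.symm.le.trans ?_)
  exact hsum.le.trans (add_le_add hup le_rfl)

/-- The constant by which halo sets gain density inside members of a convex basis. -/
noncomputable def gainConst (n : ℕ) : ℝ := 1 / (2 * 12 ^ n)

theorem gainConst_pos (n : ℕ) : 0 < gainConst n := by unfold gainConst; positivity

theorem gainConst_le_one (n : ℕ) : gainConst n ≤ 1 := by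
  unfold gainConst
  rw [div_le_one (by positivity)]
  have : (1 : ℝ) ≤ 12 ^ n := one_le_pow₀ (by norm_num)
  linarith

theorem volume_enlargement_le (hR : IsOpen R) (hconv : Convex ℝ R) (hfin : volume R ≠ ∞)
    (b : EuclideanSpace ℝ (Fin n)) {t : ℝ} (ht : 0 < t) :
    volume (AffineMap.homothety b (3 * t) '' ((fun x => b + x) '' (R - R))) ≤
      12 ^ n * volume (AffineMap.homothety b t '' R) := by
  have h := measure_sub_le volume hconv hR hfin
  rw [finrank_euclideanSpace_fin] at h
  rw [volume_homothety_image b (by positivity), volume_homothety_image b ht.le,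
    image_add_left, measure_preimage_add, ENNReal.ofReal_mul (by norm_num), ENNReal.ofReal_ofNat]
  calc (3 * ENNReal.ofReal t) ^ n * volume (R - R)
      ≤ (3 * ENNReal.ofReal t) ^ n * (4 ^ n * volume R) := by gcongr
    _ = (3 * 4) ^ n * (ENNReal.ofReal t ^ n * volume R) := by rw [mul_pow, mul_pow]; ring
    _ = _ := by norm_num

/-- Disjoint selected homothets, enlarged at a cost of `12 ^ n` in volume, cover almost all of `E ∩
R`. Each has proportion at least `(1 - γ) / 2` outside `E` but inside the halo set; the quotient of
the two factors is `gainConst n * (1 - γ)`. -/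
theorem measure_inter_haloSet_ge (hB : IsDensityBasis B) (hhom : HomothecyInvariant B)
    (hE : MeasurableSet E) (hR : R ∈ B) (hconv : Convex ℝ R) {γ : ℝ} (hγ0 : 0 < γ) (hγ1 : γ < 1)
    (h : volume (E ∩ R) ≤ ENNReal.ofReal γ * volume R) :
    ENNReal.ofReal (1 + gainConst n * (1 - γ)) * volume (E ∩ R) ≤
      volume (haloSet B γ E ∩ R) := by
  have hRo := (hB.1 R hR).1
  have hRfin := hB.1.measure_ne_top hR
  have hae := ae_exists_homothety hB hhom hE hR hconv hγ0 hγ1 h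
  set P : EuclideanSpace ℝ (Fin n) → ℝ → Prop := fun x t => 0 < t ∧ t ≤ 1 ∧
      ENNReal.ofReal γ * volume (AffineMap.homothety x t '' R) <
        volume (E ∩ AffineMap.homothety x t '' R) ∧
      ENNReal.ofReal ((1 - γ) / 2) * volume (AffineMap.homothety x t '' R) ≤
        volume (AffineMap.homothety x t '' R \ E) with hP
  set G := {x | x ∈ E ∩ R ∧ ∃ t, P x t} with hG
  have hGE : volume (E ∩ R) ≤ volume G :=
    measure_mono_ae (by filter_upwards [hae] with x hx hxm using ⟨hxm, hx hxm⟩)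
  choose! t ht using fun (x : EuclideanSpace ℝ (Fin n)) (hx : x ∈ G) => hx.2
  set H := haloSet B γ E
  set S : EuclideanSpace ℝ (Fin n) → Set (EuclideanSpace ℝ (Fin n)) :=
    fun x => AffineMap.homothety x (t x) '' R with hS
  have hSB : ∀ x ∈ G, S x ∈ B := fun x hx => homothety_image_mem hhom hR x (ht x hx).1
  have hxS : ∀ x ∈ G, x ∈ S x := fun x hx => ⟨x, hx.1.2, by simp⟩
  have hSR : ∀ x ∈ G, S x ⊆ R := fun x hx =>
    homothety_image_subset hconv hx.1.2 ⟨(ht x hx).1.le, (ht x hx).2.1⟩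
  have hSH : ∀ x ∈ G, S x ⊆ H := fun x hx y hy =>
    (mem_haloSet_iff hB.1 hE).2 ⟨S x, hSB x hx, hy, (ht x hx).2.2.1⟩
  -- Sizes are compared through the ratios `t`; only the centres need covering.
  obtain ⟨u, huG, hdisj, hcov⟩ := Vitali.exists_disjoint_subfamily_covering_enlargement S G t 2
    one_lt_two (fun x hx => (ht x hx).1.le) 1 (fun x hx => (ht x hx).2.1)
    (fun x hx => ⟨x, hxS x hx⟩)
  have hSo : ∀ x ∈ u, IsOpen (S x) := fun x hx => (hB.1 _ (hSB x (huG hx))).1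
  have hu : u.Countable := hdisj.countable_of_isOpen hSo fun x hx => ⟨x, hxS x (huG hx)⟩
  have hGcov : G ⊆ ⋃ b ∈ u, AffineMap.homothety b (3 * t b) '' ((fun x => b + x) '' (R - R)) := by
    intro a ha
    obtain ⟨b, hb, hab, htab⟩ := hcov a ha
    exact mem_biUnion hb (center_mem_of_homothety_inter hconv ha.1.2 (huG hb).1.2 (ht a ha).1.le
      (ht b (huG hb)).1 htab hab)
  have hHo : MeasurableSet H := (isOpen_haloSet hB.1 hE γ).measurableSet
  have hgain : ENNReal.ofReal ((1 - γ) / 2) * volume G ≤ 12 ^ n * volume ((H ∩ R) \ E) := by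
    calc ENNReal.ofReal ((1 - γ) / 2) * volume G
        ≤ ENNReal.ofReal ((1 - γ) / 2) * ∑' b : u, 12 ^ n * volume (S b) := by
          gcongr
          refine (measure_mono hGcov).trans ((measure_biUnion_le _ hu _).trans ?_)
          exact ENNReal.tsum_le_tsum fun b =>
            volume_enlargement_le hRo hconv hRfin _ (ht b (huG b.2)).1
      _ = 12 ^ n * ∑' b : u, ENNReal.ofReal ((1 - γ) / 2) * volume (S b) := by
          rw [ENNReal.tsum_mul_left, ENNReal.tsum_mul_left]
          ring
      _ ≤ 12 ^ n * ∑' b : u, volume (S b \ E) := by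
          gcongr with b
          exact (ht b (huG b.2)).2.2.2
      _ = 12 ^ n * volume (⋃ b ∈ u, S b \ E) := by
          rw [measure_biUnion hu (hdisj.mono fun x => sdiff_subset)
            fun b hb => (hSo b hb).measurableSet.diff hE]
      _ ≤ 12 ^ n * volume ((H ∩ R) \ E) := by
          gcongr
          exact iUnion₂_subset fun b hb => sdiff_subset_sdiff_left
            (subset_inter (hSH b (huG hb)) (hSR b (huG hb)))
  have hconst : (12 : ℝ≥0∞) ^ n * ENNReal.ofReal (gainConst n * (1 - γ)) =
      ENNReal.ofReal ((1 - γ) / 2) := by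
    have : (12 : ℝ≥0∞) ^ n = ENNReal.ofReal (12 ^ n) := by
      rw [ENNReal.ofReal_pow (by norm_num), ENNReal.ofReal_ofNat]
    rw [this, ← ENNReal.ofReal_mul (by positivity), gainConst]
    congr 1
    field_simp
  have hgain' : ENNReal.ofReal (gainConst n * (1 - γ)) * volume G ≤ volume ((H ∩ R) \ E) := by
    rw [← hconst, mul_assoc] at hgain
    exact (ENNReal.mul_le_mul_iff_right (by simp) (by simp)).1 hgain
  have hGH : G ⊆ (H ∩ R) ∩ E := fun x hx => ⟨⟨hSH x hx (hxS x hx), hx.1.2⟩, hx.1.1⟩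
  rw [← measure_inter_add_sdiff (H ∩ R) hE, ENNReal.ofReal_add zero_le_one
    (mul_nonneg (gainConst_pos n).le (by linarith)), ENNReal.ofReal_one, add_mul, one_mul]
  refine add_le_add (hGE.trans (measure_mono hGH)) (le_trans ?_ hgain')
  gcongr

/-- In an `R` witnessing the `α`-halo, either `E` has density at most `γ` and the gain applies, or
`R` lies wholly in the `γ`-halo, where density `1` beats the new threshold. -/
theorem haloSet_subset_haloSet_haloSet (hB : IsDensityBasis B) (hhom : HomothecyInvariant B)
    (hconv : ∀ R ∈ B, Convex ℝ R) (hE : MeasurableSet E) {α γ : ℝ}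
    (hγ0 : 0 < γ) (hγ1 : γ < 1) (hβ : α * (1 + gainConst n * (1 - γ)) < 1) :
    haloSet B α E ⊆ haloSet B (α * (1 + gainConst n * (1 - γ))) (haloSet B γ E) := by
  intro x hx
  obtain ⟨R, hR, hxR, h⟩ := (mem_haloSet_iff hB.1 hE).1 hx
  refine (mem_haloSet_iff hB.1 (isOpen_haloSet hB.1 hE γ).measurableSet).2 ⟨R, hR, hxR, ?_⟩
  have hR0 := ((hB.1 R hR).1.measure_pos volume ⟨x, hxR⟩).ne'
  have hRfin := hB.1.measure_ne_top hR
  have hg : 0 < 1 + gainConst n * (1 - γ) := by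
    have := mul_pos (gainConst_pos n) (sub_pos.2 hγ1)
    linarith
  rcases le_or_gt (volume (E ∩ R)) (ENNReal.ofReal γ * volume R) with hle | hlt
  · refine lt_of_lt_of_le ?_ (measure_inter_haloSet_ge hB hhom hE hR (hconv R hR) hγ0 hγ1 hle)
    rw [mul_comm α, ENNReal.ofReal_mul hg.le, mul_assoc]
    exact (ENNReal.mul_lt_mul_iff_right (by simpa using hg) ENNReal.ofReal_ne_top).2 h
  · have hsub : R ⊆ haloSet B γ E := fun y hy =>
      (mem_haloSet_iff hB.1 hE).2 ⟨R, hR, hy, hlt⟩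
    rw [inter_eq_self_of_subset_right hsub]
    conv_rhs => rw [← one_mul (volume R)]
    refine (ENNReal.mul_lt_mul_iff_left hR0 hRfin).2 ?_
    rwa [← ENNReal.ofReal_one, ENNReal.ofReal_lt_ofReal_iff one_pos]

theorem sharpTauberian_le_mul (hB : IsDensityBasis B) (hhom : HomothecyInvariant B)
    (hconv : ∀ R ∈ B, Convex ℝ R) {α γ : ℝ} (hγ0 : 0 < γ) (hγ1 : γ < 1)
    (hfin : sharpTauberian B γ ≠ ∞) (hβ : α * (1 + gainConst n * (1 - γ)) < 1) :
    sharpTauberian B α ≤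
      sharpTauberian B (α * (1 + gainConst n * (1 - γ))) * sharpTauberian B γ := by
  refine iSup_le fun E => iSup_le fun hE => iSup_le fun h0 => iSup_le fun htop => ?_
  have h1 := measure_haloSet_le hB.1 hE htop.ne γ
  have h2 : volume (haloSet B γ E) ≠ ∞ :=
    ne_top_of_le_ne_top (ENNReal.mul_ne_top hfin htop.ne) h1
  rw [ENNReal.div_le_iff h0.ne' htop.ne]
  calc volume (haloSet B α E)
      ≤ volume (haloSet B (α * (1 + gainConst n * (1 - γ))) (haloSet B γ E)) :=
        measure_mono (haloSet_subset_haloSet_haloSet hB hhom hconv hE hγ0 hγ1 hβ)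
    _ ≤ sharpTauberian B (α * (1 + gainConst n * (1 - γ))) * volume (haloSet B γ E) :=
        measure_haloSet_le hB.1 (isOpen_haloSet hB.1 hE γ).measurableSet h2 _
    _ ≤ sharpTauberian B (α * (1 + gainConst n * (1 - γ))) *
        (sharpTauberian B γ * volume E) := by gcongr
    _ = _ := (mul_assoc _ _ _).symm

end Basis

end Halo

namespace Halo

/-! ### Finiteness and Hölder bounds from the functional inequality. -/

section HolderOfSubmultiplicative

/-- The Hölder condition on a subset of `ℝ` may be checked on ordered pairs. -/
theorem holderOnWith_of_abs_sub_le {f : ℝ → ℝ} {K : Set ℝ} {p : ℝ≥0} {L : ℝ} (hL : 0 ≤ L)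
    (h : ∀ x ∈ K, ∀ y ∈ K, x ≤ y → |f x - f y| ≤ L * (y - x) ^ (p : ℝ)) :
    HolderOnWith L.toNNReal p f K := by
  have key : ∀ x ∈ K, ∀ y ∈ K, x ≤ y →
      edist (f x) (f y) ≤ L.toNNReal * edist x y ^ (p : ℝ) := by
    intro x hx y hy hxy
    rw [edist_dist, edist_dist, ENNReal.ofReal_rpow_of_nonneg dist_nonneg p.coe_nonneg,
      Real.dist_eq, Real.dist_eq, abs_sub_comm x y, abs_of_nonneg (sub_nonneg.2 hxy)]
    change _ ≤ ENNReal.ofReal L * _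
    rw [← ENNReal.ofReal_mul hL]
    exact ENNReal.ofReal_le_ofReal (h x hx y hy hxy)
  intro x hx y hy
  rcases le_total x y with hxy | hxy
  · exact key x hx y hy hxy
  · rw [edist_comm, edist_comm x y]
    exact key y hy x hx hxy

/-- With `γ` fixed, each use of the inequality multiplies the argument by `q > 1`, so finitely many
reach the range where `C` is known to be finite. -/
theorem ne_top_of_le_mul {C : ℝ → ℝ≥0∞} {c γ₀ : ℝ} (hc0 : 0 < c) (hc1 : c ≤ 1)
    (hγ₀ : 0 < γ₀) (hγ₁ : γ₀ < 1) (hfin : ∀ γ ∈ Ioo γ₀ 1, C γ ≠ ∞)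
    (hmul : ∀ α > 0, ∀ γ ∈ Ioo γ₀ 1, α * (1 + c * (1 - γ)) < 1 →
      C α ≤ C (α * (1 + c * (1 - γ))) * C γ) :
    ∀ α ∈ Ioo (0 : ℝ) 1, C α ≠ ∞ := by
  obtain ⟨γ, hγ⟩ := exists_between hγ₁
  set q := 1 + c * (1 - γ) with hq
  have hq1 : 1 < q := by
    have : 0 < c * (1 - γ) := mul_pos hc0 (sub_pos.2 hγ.2)
    linarith
  -- Prevents overshooting: if `α * q ≥ 1`, then already `α > γ₀`.
  have hqγ : q * γ₀ < 1 := by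
    have h1 : q ≤ 1 + (1 - γ) := by
      have := mul_le_mul_of_nonneg_right hc1 (sub_pos.2 hγ.2).le
      linarith
    have h2 : q * γ₀ ≤ (1 + (1 - γ)) * γ₀ := mul_le_mul_of_nonneg_right h1 hγ₀.le
    nlinarith [hγ.1, hγ.2]
  have step : ∀ k : ℕ, ∀ α ∈ Ioo (0 : ℝ) 1, γ₀ < α * q ^ k → C α ≠ ∞ := by
    intro k
    induction k with
    | zero =>
      intro α hα h
      exact hfin α ⟨by simpa using h, hα.2⟩
    | succ k ih =>
      intro α hα h
      rcases lt_or_ge (α * q) 1 with h1 | h1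
      · refine ne_top_of_le_ne_top (ENNReal.mul_ne_top ?_ (hfin γ hγ)) (hmul α hα.1 γ hγ h1)
        exact ih _ ⟨mul_pos hα.1 (by linarith), h1⟩ (by rwa [mul_assoc, ← pow_succ'])
      · refine hfin α ⟨?_, hα.2⟩
        by_contra hcon
        have := mul_le_mul_of_nonneg_right (not_lt.1 hcon) (by linarith : 0 ≤ q)
        linarith
  intro α hα
  obtain ⟨k, hk⟩ := pow_unbounded_of_one_lt (γ₀ / α) hq1
  exact step k α hα (by rwa [div_lt_iff₀' hα.1] at hk)

variable {D : ℝ → ℝ} {c γ₀ A p : ℝ}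

theorem exists_holder_bound (hc0 : 0 < c) (hγ₁ : γ₀ < 1) (hA : 0 ≤ A) (hp : 0 < p)
    (hone : ∀ α ∈ Ioo (0 : ℝ) 1, 1 ≤ D α)
    (hanti : AntitoneOn D (Ioo 0 1))
    (hsol : ∀ γ ∈ Ioo γ₀ 1, D γ ≤ 1 + A * (1 - γ) ^ p)
    (hmul : ∀ α > 0, ∀ γ ∈ Ioo γ₀ 1, α * (1 + c * (1 - γ)) < 1 →
      D α ≤ D (α * (1 + c * (1 - γ))) * D γ) {a : ℝ} (ha : a ∈ Ioo (0 : ℝ) 1) :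
    ∃ L, 0 ≤ L ∧ ∀ α β, a ≤ α → α ≤ β → β < 1 → |D α - D β| ≤ L * (β - α) ^ p := by
  have ha0 := ha.1
  have hg : 0 < 1 - γ₀ := sub_pos.2 hγ₁
  have hDa : 0 ≤ D a := zero_le_one.trans (hone a ha)
  refine ⟨D a * (A / (c * a) ^ p + 1 / (c * a * (1 - γ₀)) ^ p), by positivity, ?_⟩
  intro α β haα hαβ hβ
  have hα0 : 0 < α := ha0.trans_le haα
  have hαm : α ∈ Ioo (0 : ℝ) 1 := ⟨hα0, hαβ.trans_lt hβ⟩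
  have hβm : β ∈ Ioo (0 : ℝ) 1 := ⟨hα0.trans_le hαβ, hβ⟩
  have hDα : D α ≤ D a := hanti ha hαm haα
  have hDβ : D β ≤ D a := hanti ha hβm (haα.trans hαβ)
  have hβ1 := hone β hβm
  rw [abs_of_nonneg (sub_nonneg.2 (hanti hαm hβm hαβ))]
  rcases hαβ.eq_or_lt with rfl | hlt
  · simp [Real.zero_rpow hp.ne']
  have hd : 0 < β - α := sub_pos.2 hlt
  rw [mul_assoc, add_mul, mul_add]
  -- Chosen so that `γ = 1 - η` satisfies `α(1 + c(1 - γ)) = β`. If `η` is too large for the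
  -- Solyanik range, `β - α` is bounded below and the trivial bound `D a` suffices.
  set η := (β - α) / (c * α) with hη
  have hη0 : 0 < η := by positivity
  rcases lt_or_ge η (1 - γ₀) with h | h
  · have e : α * (1 + c * (1 - (1 - η))) = β := by
      rw [hη]; field_simp; ring
    have hγm : 1 - η ∈ Ioo γ₀ 1 := ⟨by linarith, by linarith⟩
    have h1 := hmul α hα0 (1 - η) hγm (by rwa [e])
    have h2 := hsol (1 - η) hγm
    rw [e] at h1
    rw [sub_sub_cancel] at h2
    have h3 : η ^ p ≤ (β - α) ^ p / (c * a) ^ p := by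
      rw [← Real.div_rpow hd.le (by positivity)]
      exact Real.rpow_le_rpow hη0.le (by rw [hη]; gcongr) hp.le
    calc D α - D β ≤ D β * (1 + A * η ^ p) - D β := by
          have := mul_le_mul_of_nonneg_left h2 (by linarith : 0 ≤ D β)
          linarith
      _ = D β * (A * η ^ p) := by ring
      _ ≤ D a * (A * ((β - α) ^ p / (c * a) ^ p)) := by gcongr
      _ = D a * (A / (c * a) ^ p * (β - α) ^ p) + 0 := by ring
      _ ≤ _ := by gcongr; positivity
  · have h1 : c * a * (1 - γ₀) ≤ β - α := by
      rw [hη, le_div_iff₀ (by positivity)] at h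
      have : c * a * (1 - γ₀) ≤ c * α * (1 - γ₀) := by gcongr
      linarith
    have h2 : 1 ≤ 1 / (c * a * (1 - γ₀)) ^ p * (β - α) ^ p := by
      rw [one_div_mul_eq_div, one_le_div (by positivity)]
      exact Real.rpow_le_rpow (by positivity) h1 hp.le
    calc D α - D β ≤ 0 + D a * 1 := by linarith
      _ ≤ _ := by gcongr; positivity

/-- Controls the approach to the limiting value `1`, needed where the two branches of the halo
function meet. -/
theorem exists_holder_bound_one (hγ₁ : γ₀ < 1) (hA : 0 ≤ A) (hp : 0 < p)
    (hone : ∀ α ∈ Ioo (0 : ℝ) 1, 1 ≤ D α)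
    (hanti : AntitoneOn D (Ioo 0 1))
    (hsol : ∀ γ ∈ Ioo γ₀ 1, D γ ≤ 1 + A * (1 - γ) ^ p) {a : ℝ} (ha : a ∈ Ioo (0 : ℝ) 1) :
    ∃ L, 0 ≤ L ∧ ∀ α, a ≤ α → α < 1 → D α - 1 ≤ L * (1 - α) ^ p := by
  have hg : 0 < 1 - γ₀ := sub_pos.2 hγ₁
  have hDa : 0 ≤ D a := zero_le_one.trans (hone a ha)
  refine ⟨A + D a / (1 - γ₀) ^ p, by positivity, fun α haα hα => ?_⟩
  have hα' : 0 < 1 - α := sub_pos.2 hα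
  rw [add_mul]
  rcases lt_or_ge γ₀ α with h | h
  · have h1 := hsol α ⟨h, hα⟩
    have : 0 ≤ D a / (1 - γ₀) ^ p * (1 - α) ^ p := by positivity
    linarith
  · have h1 : (1 - γ₀) ^ p ≤ (1 - α) ^ p := Real.rpow_le_rpow hg.le (by linarith) hp.le
    have h2 : D a ≤ D a / (1 - γ₀) ^ p * (1 - α) ^ p := by
      rw [div_mul_eq_mul_div, le_div_iff₀ (by positivity)]
      gcongr
    have h3 := hanti ha ⟨ha.1.trans_le haα, hα⟩ haα
    have : 0 ≤ A * (1 - α) ^ p := by positivity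
    linarith

/-- Extending `a ↦ D (1 / a)` by the identity below `1` preserves the local Hölder condition. -/
theorem exists_holder_bound_extension {φ : ℝ → ℝ} (hp0 : 0 < p) (hp1 : p ≤ 1)
    (hone : ∀ α ∈ Ioo (0 : ℝ) 1, 1 ≤ D α)
    (hD : ∀ a ∈ Ioo (0 : ℝ) 1, ∃ L, 0 ≤ L ∧
      ∀ α β, a ≤ α → α ≤ β → β < 1 → |D α - D β| ≤ L * (β - α) ^ p)
    (hD1 : ∀ a ∈ Ioo (0 : ℝ) 1, ∃ L, 0 ≤ L ∧ ∀ α, a ≤ α → α < 1 → D α - 1 ≤ L * (1 - α) ^ p)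
    (hle : ∀ x, 0 ≤ x → x ≤ 1 → φ x = x) (hgt : ∀ x, 1 < x → φ x = D (1 / x)) {b : ℝ}
    (hb : 1 < b) :
    ∃ L, 0 ≤ L ∧ ∀ x y, 0 ≤ x → x ≤ y → y ≤ b → |φ x - φ y| ≤ L * (y - x) ^ p := by
  have hb' : 1 / b ∈ Ioo (0 : ℝ) 1 := ⟨by positivity, (div_lt_one (by linarith)).2 hb⟩
  obtain ⟨L, hL, h⟩ := hD _ hb'
  obtain ⟨L', hL', h'⟩ := hD1 _ hb'
  refine ⟨1 + L + L', by positivity, fun x y hx hxy hyb => ?_⟩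
  have unit : ∀ r : ℝ, 0 ≤ r → r ≤ 1 → r ≤ r ^ p := by
    intro r h0 h1
    rcases h0.eq_or_lt with rfl | h0
    · simp [Real.zero_rpow hp0.ne']
    · simpa using Real.rpow_le_rpow_of_exponent_ge h0 h1 hp1
  have hP : 0 ≤ (y - x) ^ p := Real.rpow_nonneg (sub_nonneg.2 hxy) p
  have hLP := mul_nonneg hL hP
  have hLP' := mul_nonneg hL' hP
  have inv_mem : ∀ z, 1 < z → z ≤ b → 1 / b ≤ 1 / z ∧ 1 / z < 1 := fun z hz hzb =>
    ⟨one_div_le_one_div_of_le (by linarith) hzb, (div_lt_one (by linarith)).2 hz⟩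
  rw [add_mul, add_mul, one_mul]
  rcases le_or_gt y 1 with hy | hy
  · rw [hle x hx (hxy.trans hy), hle y (hx.trans hxy) hy, abs_sub_comm,
      abs_of_nonneg (sub_nonneg.2 hxy)]
    have := unit (y - x) (sub_nonneg.2 hxy) (by linarith)
    linarith
  obtain ⟨hy1, hy2⟩ := inv_mem y hy hyb
  -- When `x ≤ 1 < y`, the increment passes through the value `1`: it is `(D (1 / y) - 1) + (1 -
  -- x)`.
  rcases le_or_gt x 1 with hx1 | hx1
  · have h1 := h' _ hy1 hy2
    have h2 : (1 - 1 / y) ^ p ≤ (y - x) ^ p := by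
      refine Real.rpow_le_rpow (by linarith) ?_ hp0.le
      have : 1 - 1 / y = (y - 1) / y := by field_simp
      rw [this]
      exact (div_le_self (by linarith) hy.le).trans (by linarith)
    have h3 : (1 - x) ^ p ≤ (y - x) ^ p :=
      Real.rpow_le_rpow (by linarith) (by linarith) hp0.le
    have h4 := unit (1 - x) (by linarith) (by linarith)
    have h5 := hone (1 / y) ⟨by positivity, hy2⟩
    have h6 := mul_le_mul_of_nonneg_left h2 hL'
    rw [hle x hx hx1, hgt y hy, abs_sub_comm, abs_of_nonneg (by linarith)]
    linarith
  · obtain ⟨hx2, hx3⟩ := inv_mem x hx1 (hxy.trans hyb)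
    have h1 := h (1 / y) (1 / x) hy1 (one_div_le_one_div_of_le (by linarith) hxy) hx3
    have h2 : (1 / x - 1 / y) ^ p ≤ (y - x) ^ p := by
      have hxy1 : 1 ≤ x * y := by nlinarith
      have : 1 / x - 1 / y = (y - x) / (x * y) := by field_simp
      rw [this]
      exact Real.rpow_le_rpow (div_nonneg (by linarith) (by linarith))
        (div_le_self (by linarith) hxy1) hp0.le
    have h6 := mul_le_mul_of_nonneg_left h2 hL
    rw [hgt x hx1, hgt y hy, abs_sub_comm]
    linarith

end HolderOfSubmultiplicative

end Halo

/-! ### Assembly for the Tauberian constant and the halo function. -/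

theorem mainTheorem1 (n : ℕ) (B : Set (Set (EuclideanSpace ℝ (Fin n))))
    (hB : Halo.IsDensityBasis B) (hhom : Halo.HomothecyInvariant B)
    (hconv : ∀ R ∈ B, Convex ℝ R)
    (p : ℝ≥0) (hp0 : 0 < p) (hp1 : p < 1) (hsol : Halo.SolyanikEstimate B p) :
    ((∀ α ∈ Ioo (0 : ℝ) 1, Halo.sharpTauberian B α ≠ ∞) ∧
      Halo.LocallyHolder p (fun α => (Halo.sharpTauberian B α).toReal) (Ioo 0 1)) ∧
    ((∀ a ∈ Ici (0 : ℝ), Halo.haloFunction B a ≠ ∞) ∧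
      Halo.LocallyHolder p (fun a => (Halo.haloFunction B a).toReal) (Ici 0)) := by
  open Halo in
  obtain ⟨A₀, hA₀⟩ := hsol
  obtain ⟨γ₁, hγ₁, hsol₁⟩ := (mem_nhdsLT_iff_exists_Ioo_subset' (zero_lt_one' ℝ)).1 hA₀
  -- The maximum with `1 / 2` keeps the threshold positive, as the density argument requires.
  set γ₀ := max γ₁ (1 / 2) with hγ₀
  have hγ₀0 : 0 < γ₀ := lt_max_of_lt_right (by norm_num)
  have hγ₀1 : γ₀ < 1 := max_lt hγ₁ (by norm_num)
  set A := max A₀ 0 with hA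
  have hA0 : 0 ≤ A := le_max_right _ _
  have hp0' : (0 : ℝ) < p := hp0
  have hp1' : (p : ℝ) ≤ 1 := by exact_mod_cast hp1.le
  have hsol₂ : ∀ γ ∈ Ioo γ₀ 1,
      sharpTauberian B γ ≤ ENNReal.ofReal (1 + A * (1 - γ) ^ (p : ℝ)) := by
    intro γ hγ
    have h1 : 0 ≤ (1 - γ) ^ (p : ℝ) := Real.rpow_nonneg (by linarith [hγ.2]) _
    have h2 : sharpTauberian B γ - 1 ≤ ENNReal.ofReal (A₀ * (1 - γ) ^ (p : ℝ)) :=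
      hsol₁ ⟨(le_max_left _ _).trans_lt hγ.1, hγ.2⟩
    rw [tsub_le_iff_left] at h2
    rw [ENNReal.ofReal_add zero_le_one (by positivity), ENNReal.ofReal_one]
    refine h2.trans ?_
    gcongr
    exact le_max_left _ _
  have hfin₀ : ∀ γ ∈ Ioo γ₀ 1, sharpTauberian B γ ≠ ∞ := fun γ hγ =>
    ne_top_of_le_ne_top ENNReal.ofReal_ne_top (hsol₂ γ hγ)
  have hmul : ∀ α > 0, ∀ γ ∈ Ioo γ₀ 1, α * (1 + gainConst n * (1 - γ)) < 1 →
      sharpTauberian B α ≤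
        sharpTauberian B (α * (1 + gainConst n * (1 - γ))) * sharpTauberian B γ :=
    fun α _ γ hγ hβ => sharpTauberian_le_mul hB hhom hconv (hγ₀0.trans hγ.1) hγ.2 (hfin₀ γ hγ) hβ
  have hfin : ∀ α ∈ Ioo (0 : ℝ) 1, sharpTauberian B α ≠ ∞ :=
    ne_top_of_le_mul (gainConst_pos n) (gainConst_le_one n) hγ₀0 hγ₀1 hfin₀ hmul
  set D : ℝ → ℝ := fun α => (sharpTauberian B α).toReal with hD
  have hone : ∀ α ∈ Ioo (0 : ℝ) 1, 1 ≤ D α := fun α hα => by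
    simpa using ENNReal.toReal_mono (hfin α hα) (one_le_sharpTauberian hB hα.2)
  have hanti : AntitoneOn D (Ioo 0 1) := fun α hα β _ h =>
    ENNReal.toReal_mono (hfin α hα) (sharpTauberian_antitone h)
  have hsolD : ∀ γ ∈ Ioo γ₀ 1, D γ ≤ 1 + A * (1 - γ) ^ (p : ℝ) := fun γ hγ => by
    have h1 : 0 ≤ (1 - γ) ^ (p : ℝ) := Real.rpow_nonneg (by linarith [hγ.2]) _
    exact ENNReal.toReal_le_of_le_ofReal (by positivity) (hsol₂ γ hγ)
  have hmulD : ∀ α > 0, ∀ γ ∈ Ioo γ₀ 1, α * (1 + gainConst n * (1 - γ)) < 1 →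
      D α ≤ D (α * (1 + gainConst n * (1 - γ))) * D γ := by
    intro α hα γ hγ hβ
    have hpos := mul_pos hα (add_pos one_pos (mul_pos (gainConst_pos n) (sub_pos.2 hγ.2)))
    rw [hD, ← ENNReal.toReal_mul]
    exact ENNReal.toReal_mono (ENNReal.mul_ne_top (hfin _ ⟨hpos, hβ⟩) (hfin₀ γ hγ))
      (hmul α hα γ hγ hβ)
  have hbound := fun a (ha : a ∈ Ioo (0 : ℝ) 1) =>
    exists_holder_bound (gainConst_pos n) hγ₀1 hA0 hp0' hone hanti hsolD hmulD ha
  have hbound' := fun a (ha : a ∈ Ioo (0 : ℝ) 1) =>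
    exists_holder_bound_one hγ₀1 hA0 hp0' hone hanti hsolD ha
  refine ⟨⟨hfin, fun K hK hKc => ?_⟩, fun a ha => ?_, fun K hK hKc => ?_⟩
  · rcases K.eq_empty_or_nonempty with rfl | hne
    · exact ⟨0, fun x hx => hx.elim⟩
    obtain ⟨a, haK, hmin⟩ := hKc.exists_isLeast hne
    obtain ⟨L, hL, h⟩ := hbound a (hK haK)
    exact ⟨L.toNNReal, holderOnWith_of_abs_sub_le hL fun x hx y hy hxy =>
      h x y (hmin hx) hxy (hK hy).2⟩
  · rw [haloFunction]
    split_ifs with h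
    · exact ENNReal.ofReal_ne_top
    · have h1 : 1 < a := not_le.1 h
      exact hfin _ ⟨by positivity, (div_lt_one (by linarith)).2 h1⟩
  · obtain ⟨b, hb⟩ := hKc.bddAbove
    -- The extension bound needs an endpoint beyond `1`, which `K` may not reach.
    obtain ⟨L, hL, h⟩ := exists_holder_bound_extension (b := max b 2)
      (φ := fun a => (haloFunction B a).toReal) hp0' hp1' hone hbound hbound'
      (fun x hx0 hx1 => by simp [haloFunction, hx1, hx0])
      (fun x hx => by simp [haloFunction, not_le.2 hx, hD]) (lt_max_of_lt_right one_lt_two)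
    exact ⟨L.toNNReal, holderOnWith_of_abs_sub_le hL fun x hx y hy hxy =>
      h x y (hK hx) hxy ((hb hy).trans (le_max_left _ _))⟩
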